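/- For $\ell\ge 3$ let $H(\ell,3)$ be the graph consisting of a cycle of length $\ell$ and a triangle that have exactly one vertex in common. A graph is $\{H(3,3),H(4,3)\}$-free if it contains no subgraph (induced or not) isomorphic to $H(3,3)$ or to $H(4,3)$. For a finite simple graph $G$ let $\rho(G)$ be the largest eigenvalue of its adjacency matrix. Let $S_{n,2}$ be the graph on $n$ vertices obtained by joining both vertices of $K_2$ to each of $n-2$ pairwise non-adjacent vertices. Theorem 1.1. Let $m\ge 259$ be odd. If $G$ is a finite simple $\{H(3,3),H(4,3)\}$-free graph with exactly $m$ edges and no isolated vertices, then $$\rho(G)\le \frac{1+\sqrt{4m-3}}{2},$$ with equality if and only if $G\cong S_{\frac{m+3}{2},2}$. Moreover, $S_{\frac{m+3}{2},2}$ is itself $\{H(3,3),H(4,3)\}$-free, has no isolated vertices and exactly $m$ edges, and $\rho\bigl(S_{\frac{m+3}{2},2}\bigr)=\frac{1+\sqrt{4m-3}}{2}$; so it is, up to isomorphism, the unique graph of maximum spectral radius among all such graphs. -/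

import Mathlib

/-- The graph `H(ℓ,3)`, for `ℓ ≥ 3`: a cycle of length `ℓ` (on the vertices `inl i`) and a triangle
(on `inl 0`, `inr 0`, `inr 1`) which have exactly the vertex `inl 0` in common. -/
def cycleTriangle (l : ℕ) : SimpleGraph (Fin l ⊕ Fin 2) where
  Adj
    | Sum.inl i, Sum.inl j => (SimpleGraph.cycleGraph l).Adj i j
    | Sum.inl i, Sum.inr _ => i.val = 0
    | Sum.inr _, Sum.inl j => j.val = 0
    | Sum.inr a, Sum.inr b => a ≠ b
  symm := ⟨by
    rintro (i | a) (j | b) h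
    · exact SimpleGraph.Adj.symm h
    · exact h
    · exact h
    · exact Ne.symm h⟩
  loopless := ⟨by
    rintro (i | a) h
    · exact SimpleGraph.irrefl _ h
    · exact h rfl⟩

/-- The graph `S_{n,k}`, for `k ≤ n`: every vertex of the complete graph `K_k` (the vertices
`0, …, k - 1`) is joined to `n - k` further, pairwise non-adjacent vertices. -/
def completeSplit (n k : ℕ) : SimpleGraph (Fin n) where
  Adj i j := i ≠ j ∧ (i.val < k ∨ j.val < k)
  symm := ⟨fun _ _ h => ⟨h.1.symm, h.2.symm⟩⟩
  loopless := ⟨fun _ h => h.1 rfl⟩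

open Classical in
/-- The largest eigenvalue of the adjacency matrix of a finite graph. -/
noncomputable def adjSpectralRadius {V : Type*} [Fintype V] (G : SimpleGraph V) : ℝ :=
  sSup (spectrum ℝ (G.adjMatrix ℝ))

open Classical in
/-- The supremum in the definition of `adjSpectralRadius` is a maximum. -/
theorem adjSpectralRadius_isGreatest {V : Type*} [Fintype V] [Nonempty V] (G : SimpleGraph V) :
    IsGreatest (spectrum ℝ (G.adjMatrix ℝ)) (adjSpectralRadius G) := by
  have hfin : (spectrum ℝ (G.adjMatrix ℝ)).Finite := Matrix.finite_real_spectrum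
  have hne : (spectrum ℝ (G.adjMatrix ℝ)).Nonempty := by
    rw [(G.isHermitian_adjMatrix ℝ).spectrum_real_eq_range_eigenvalues]
    exact Set.range_nonempty _
  exact ⟨hne.csSup_mem hfin, fun _ h => le_csSup hfin.bddAbove h⟩

/-- `G` is `{H(3,3), H(4,3)}`-free (no subgraph, induced or not, is isomorphic to one of the two),
has no isolated vertices, and has exactly `m` edges. -/
structure IsAdmissible {V : Type*} (G : SimpleGraph V) (m : ℕ) : Prop where
  free33 : (cycleTriangle 3).Free G
  free43 : (cycleTriangle 4).Free G
  not_isIsolated : ∀ v, ¬ G.IsIsolated v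
  size : G.edgeSet.ncard = m

/-!
Let `r` be the spectral radius of an admissible graph `G` with `m` edges, and suppose that it
reaches the bound, that is, `m - 1 ≤ r ^ 2 - r`. Take a nonnegative eigenvector `x` for `r` whose
largest entry is `x u = 1` (`exists_nonneg_eigenvector`). Write `N` for the neighbourhood of `u`,
`W` for the set of the other vertices different from `u`, `d` for the degree, and `c v` for the
number of common neighbours of `u` and `v`. Evaluating `r ^ 2 - r` at `u` and counting all edges
gives (`sum_farFinset_add_two_mul_sq_sub`)

`∑_W ((d - c) + 2 c (1 - x)) + 2 (r ^ 2 - r) = 2 m + ∑_N (2 (c - 1) x - c)`,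

where the first sum is nonnegative. Hence the last sum is at least `-2`.

As `G` has no `H(3,3)`, any two edges inside `N` intersect, so `N` spans no edge, a star, or a
triangle, together with isolated vertices (`edgeless_or_star_or_triangle`). Without edges, or with a
triangle, the last sum is at most `6 - 2 r < -2` (`sum_neighborFinset_le_sum_codegree`), as `r > 4`.
With a star it is at most `-2` (`sum_neighborFinset_of_star`), so everything is tight:
`r ^ 2 - r = m - 1`, the star covers `N`, and every `w` in `W` has `x w = 1` and all its neighbours
in `N`. Comparing the eigenvalue equations at `w` and at `u` shows that `w` is adjacent to all of
`N`, and since `N` has more than four vertices, this produces an `H(4,3)`. So `W` is empty, and `G`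
consists of `u`, the centre of the star, and their common neighbours
(`exists_dominating_edge`).

Conversely, `S_{n,2}` is admissible because every edge meets the dominating edge and every triangle
contains it. An explicit eigenvector bounds its spectral radius from below, and the first part,
applied to `S_{n,2}` itself, gives the equality.
-/

/-! ### Nonnegative eigenvectors -/

theorem le_adjSpectralRadius_of_eigenvector {V : Type*} [Fintype V]
    (G : SimpleGraph V) [DecidableRel G.Adj] {r : ℝ} {x : V → ℝ} (hx : x ≠ 0)
    (h : ∀ v, ∑ w ∈ G.neighborFinset v, x w = r * x v) :
    r ≤ adjSpectralRadius G := by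
  classical
  obtain ⟨v₀, -⟩ := Function.ne_iff.mp hx
  have : Nonempty V := ⟨v₀⟩
  refine (adjSpectralRadius_isGreatest G).2 ?_
  rw [← Matrix.spectrum_toLin', ← Module.End.hasEigenvalue_iff_mem_spectrum]
  refine Module.End.hasEigenvalue_of_hasEigenvector (x := x) ⟨?_, hx⟩
  rw [Module.End.mem_eigenspace_iff, Matrix.toLin'_apply]
  ext v
  rw [SimpleGraph.adjMatrix_mulVec_apply, Pi.smul_apply, smul_eq_mul, ← h v]
  congr!

/-- The Perron–Frobenius statement needed here: the largest adjacency eigenvalue has a nonnegative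
eigenvector, normalised to have maximal entry `1`. If `x` is any eigenvector, then `|x|` has at
least the Rayleigh quotient of `x`, so it is an eigenvector too. -/
theorem exists_nonneg_eigenvector {V : Type*} [Fintype V] [DecidableEq V]
    (G : SimpleGraph V) [DecidableRel G.Adj] {r : ℝ}
    (hr : IsGreatest (spectrum ℝ (G.adjMatrix ℝ)) r) :
    ∃ (x : V → ℝ) (u : V), (∀ v, 0 ≤ x v) ∧ (∀ v, x v ≤ 1) ∧ x u = 1 ∧
      ∀ v, ∑ w ∈ G.neighborFinset v, x w = r * x v := by
  have hmem := hr.1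
  rw [← Matrix.spectrum_toLin', ← Module.End.hasEigenvalue_iff_mem_spectrum] at hmem
  obtain ⟨y, hy⟩ := hmem.exists_hasEigenvector
  have hyA : (G.adjMatrix ℝ).mulVec y = r • y := by
    rw [← Matrix.toLin'_apply]; exact hy.apply_eq_smul
  set B : Matrix V V ℝ := algebraMap ℝ (Matrix V V ℝ) r - G.adjMatrix ℝ with hB
  have hBmul (z : V → ℝ) : B.mulVec z = r • z - (G.adjMatrix ℝ).mulVec z := by
    rw [hB, Matrix.sub_mulVec, Algebra.algebraMap_eq_smul_one, Matrix.smul_mulVec,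
      Matrix.one_mulVec]
  have hpsd : B.PosSemidef := by
    rw [Matrix.posSemidef_iff_isHermitian_and_spectrum_nonneg]
    constructor
    · refine Matrix.IsHermitian.sub ?_ (G.isHermitian_adjMatrix ℝ)
      rw [Algebra.algebraMap_eq_smul_one]
      exact Matrix.isHermitian_one.smul (IsSelfAdjoint.all r)
    · rw [hB, ← spectrum.singleton_sub_eq]
      rintro a ⟨b, rfl, c, hc, rfl⟩
      exact sub_nonneg.mpr (hr.2 hc)
  set z : V → ℝ := fun v => |y v| with hz
  have hzB : B.mulVec z = 0 := by
    rw [← hpsd.dotProduct_mulVec_zero_iff]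
    refine le_antisymm ?_ (hpsd.dotProduct_mulVec_nonneg z)
    have h1 : star y ⬝ᵥ B.mulVec y = 0 := by rw [hBmul, hyA, sub_self, dotProduct_zero]
    rw [← h1, hBmul, hBmul]
    simp only [dotProduct, star_trivial, Pi.sub_apply, Pi.smul_apply, smul_eq_mul,
      SimpleGraph.adjMatrix_mulVec_apply, hz]
    refine Finset.sum_le_sum fun v _ => ?_
    have h2 : |y v| * (r * |y v|) = y v * (r * y v) := by
      have := abs_mul_abs_self (y v)
      linear_combination r * this
    rw [mul_sub, mul_sub, h2]
    refine sub_le_sub_left ?_ _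
    calc y v * ∑ w ∈ G.neighborFinset v, y w
        ≤ |y v| * |∑ w ∈ G.neighborFinset v, y w| := by rw [← abs_mul]; exact le_abs_self _
      _ ≤ |y v| * ∑ w ∈ G.neighborFinset v, |y w| := by
        gcongr; exact Finset.abs_sum_le_sum_abs _ _
  have hzA (v : V) : ∑ w ∈ G.neighborFinset v, z w = r * z v := by
    have h1 := congrFun hzB v
    rw [hBmul] at h1
    simp only [Pi.sub_apply, Pi.smul_apply, smul_eq_mul, Pi.zero_apply,
      SimpleGraph.adjMatrix_mulVec_apply] at h1
    linarith
  obtain ⟨v₀, hv₀⟩ := Function.ne_iff.mp hy.2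
  have : Nonempty V := ⟨v₀⟩
  obtain ⟨u, hu⟩ := Finite.exists_max z
  have hzu : 0 < z u := (abs_pos.mpr hv₀).trans_le (hu v₀)
  refine ⟨fun v => z v / z u, u, fun v => div_nonneg (abs_nonneg _) hzu.le,
    fun v => (div_le_one hzu).mpr (hu v), div_self hzu.ne', fun v => ?_⟩
  rw [← Finset.sum_div, hzA v, mul_div_assoc]

theorem SimpleGraph.Iso.adjSpectralRadius_eq {V W : Type*} [Fintype V] [Fintype W]
    {G : SimpleGraph V} {H : SimpleGraph W} (f : G ≃g H) :
    adjSpectralRadius G = adjSpectralRadius H := by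
  classical
  unfold adjSpectralRadius
  rw [← f.reindex_adjMatrix ℝ]
  exact congrArg sSup (AlgEquiv.spectrum_eq (Matrix.reindexAlgEquiv ℝ ℝ f.toEquiv) _).symm

/-! ### Counting around a vertex -/

/-- The number of common neighbours of `u` and `v`. For `v` adjacent to `u` it is the degree of `v`
inside the neighbourhood of `u`. -/
def codegree {V : Type*} [Fintype V] [DecidableEq V] (G : SimpleGraph V) [DecidableRel G.Adj]
    (u v : V) : ℕ :=
  (G.neighborFinset u ∩ G.neighborFinset v).card

/-- The vertices at distance at least two from `u`. -/
def farFinset {V : Type*} [Fintype V] [DecidableEq V] (G : SimpleGraph V) [DecidableRel G.Adj]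
    (u : V) : Finset V :=
  {w | w ≠ u ∧ ¬ G.Adj u w}

section Counting

variable {V : Type*} [Fintype V] [DecidableEq V] (G : SimpleGraph V) [DecidableRel G.Adj]

theorem mem_farFinset {u w : V} : w ∈ farFinset G u ↔ w ≠ u ∧ ¬ G.Adj u w := by
  simp [farFinset]

theorem codegree_le_degree (u v : V) : codegree G u v ≤ G.degree v :=
  Finset.card_le_card Finset.inter_subset_right

theorem sum_eq_add_sum_neighborFinset_add_sum_farFinset (u : V) (f : V → ℝ) :
    ∑ v, f v = f u + ∑ v ∈ G.neighborFinset u, f v + ∑ v ∈ farFinset G u, f v := by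
  have h1 : f u = ∑ v, if v = u then f v else 0 := by simp
  rw [h1, SimpleGraph.neighborFinset_eq_filter, farFinset, Finset.sum_filter, Finset.sum_filter,
    ← Finset.sum_add_distrib, ← Finset.sum_add_distrib]
  refine Finset.sum_congr rfl fun v _ => ?_
  by_cases h : v = u
  · subst h; simp
  · by_cases h' : G.Adj u v <;> simp [h, h']

/-- Counting walks of length two from `u` by their last vertex. -/
theorem sum_neighborFinset_sum_neighborFinset (u : V) (f : V → ℝ) :
    ∑ v ∈ G.neighborFinset u, ∑ w ∈ G.neighborFinset v, f w = ∑ w, (codegree G u w : ℝ) * f w := by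
  simp_rw [codegree, Finset.cast_card, Finset.sum_mul, one_mul]
  refine Finset.sum_comm' fun v w => ?_
  simp [G.adj_comm]

/-- The identity behind the bound. It evaluates `r ^ 2 - r` at the vertex `u` with the help of
walks of length two, and compares the result with the count of all edges. -/
theorem sum_farFinset_add_two_mul_sq_sub {x : V → ℝ} {u : V} {r : ℝ} (hu : x u = 1)
    (hx : ∀ v, ∑ w ∈ G.neighborFinset v, x w = r * x v) :
    ∑ w ∈ farFinset G u, (((G.degree w : ℝ) - codegree G u w)
        + 2 * (codegree G u w * (1 - x w))) + 2 * (r ^ 2 - r)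
      = 2 * (G.edgeFinset.card : ℝ)
        + ∑ v ∈ G.neighborFinset u, (2 * ((codegree G u v : ℝ) - 1) * x v - codegree G u v) := by
  have hc : (codegree G u u : ℝ) = G.degree u := by
    simp [codegree]
  have hdeg : (2 * G.edgeFinset.card : ℝ) = ∑ v, (G.degree v : ℝ) := by
    exact_mod_cast (G.sum_degrees_eq_twice_card_edges).symm
  have hcod : ∑ v ∈ G.neighborFinset u, (G.degree v : ℝ) = ∑ w, (codegree G u w : ℝ) := by
    have := sum_neighborFinset_sum_neighborFinset G u (fun _ => 1)
    simpa using this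
  have hsq : r ^ 2 = ∑ w, (codegree G u w : ℝ) * x w := by
    rw [← sum_neighborFinset_sum_neighborFinset, Finset.sum_congr rfl fun v _ => hx v,
      ← Finset.mul_sum, hx u, hu]
    ring
  have hr : r = ∑ v ∈ G.neighborFinset u, x v := by rw [hx u, hu, mul_one]
  rw [sum_eq_add_sum_neighborFinset_add_sum_farFinset G u] at hdeg hcod hsq
  have e1 : ∑ w ∈ farFinset G u, (((G.degree w : ℝ) - codegree G u w)
        + 2 * (codegree G u w * (1 - x w)))
      = ∑ w ∈ farFinset G u, (G.degree w : ℝ) + ∑ w ∈ farFinset G u, (codegree G u w : ℝ)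
        - 2 * ∑ w ∈ farFinset G u, (codegree G u w : ℝ) * x w := by
    rw [Finset.mul_sum, ← Finset.sum_add_distrib, ← Finset.sum_sub_distrib]
    exact Finset.sum_congr rfl fun w _ => by ring
  have e2 : ∑ v ∈ G.neighborFinset u, (2 * ((codegree G u v : ℝ) - 1) * x v - codegree G u v)
      = 2 * ∑ v ∈ G.neighborFinset u, (codegree G u v : ℝ) * x v
        - 2 * ∑ v ∈ G.neighborFinset u, x v - ∑ v ∈ G.neighborFinset u, (codegree G u v : ℝ) := by
    rw [Finset.mul_sum, Finset.mul_sum, ← Finset.sum_sub_distrib, ← Finset.sum_sub_distrib]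
    exact Finset.sum_congr rfl fun w _ => by ring
  rw [hu, hc] at hsq
  rw [hc] at hcod
  rw [e1, e2, ← hr]
  linarith

end Counting

/-! ### Forbidden subgraphs -/

section Forbidden

variable {V : Type*} {G : SimpleGraph V}

/-- In a graph without two triangles meeting in exactly one vertex, any two edges in the
neighbourhood of a vertex intersect. -/
theorem edges_meet_of_free (h : (cycleTriangle 3).Free G) {u a b c d : V}
    (ha : G.Adj u a) (hb : G.Adj u b) (hc : G.Adj u c) (hd : G.Adj u d)
    (hab : G.Adj a b) (hcd : G.Adj c d) : a = c ∨ a = d ∨ b = c ∨ b = d := by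
  by_contra! hne
  obtain ⟨h1, h2, h3, h4⟩ := hne
  refine h ⟨⟨⟨Sum.elim ![u, a, b] ![c, d], ?_⟩, ?_⟩⟩
  · rintro (i | i) (j | j) hij <;> fin_cases i <;> fin_cases j <;>
      simp_all [cycleTriangle, SimpleGraph.adj_comm]
  · rintro (i | i) (j | j) hij <;> fin_cases i <;> fin_cases j <;>
      simp_all [ha.ne, hb.ne, hc.ne, hd.ne, hab.ne, hcd.ne, ha.ne', hb.ne', hc.ne', hd.ne',
        hab.ne', hcd.ne', h1.symm, h2.symm, h3.symm, h4.symm]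

/-- The edge `c d` closes a triangle with `u`, and `u, a, w, b` is a cycle of length four. -/
theorem not_adj_of_free (h : (cycleTriangle 4).Free G) {u a b c d w : V}
    (ha : G.Adj u a) (hb : G.Adj u b) (hc : G.Adj u c) (hd : G.Adj u d) (hcd : G.Adj c d)
    (hwu : w ≠ u) (hwc : w ≠ c) (hwd : w ≠ d) (hab : a ≠ b) (hac : a ≠ c) (had : a ≠ d)
    (hbc : b ≠ c) (hbd : b ≠ d) (hwa : G.Adj w a) : ¬ G.Adj w b := by
  intro hwb
  refine h ⟨⟨⟨Sum.elim ![u, a, w, b] ![c, d], ?_⟩, ?_⟩⟩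
  · rintro (i | i) (j | j) hij <;> fin_cases i <;> fin_cases j <;>
      simp_all [cycleTriangle, SimpleGraph.adj_comm, SimpleGraph.cycleGraph_adj] <;>
      exact absurd hij (by decide)
  · rintro (i | i) (j | j) hij <;> fin_cases i <;> fin_cases j <;>
      simp_all [ha.ne, hb.ne, hc.ne, hd.ne, hcd.ne, ha.ne', hb.ne', hc.ne', hd.ne',
        hcd.ne', hwa.ne, hwa.ne', hwb.ne, hwb.ne']

/-- A graph whose edges pairwise intersect has no edges, or a vertex covering all edges, or all its
edges lie in one triangle. The graph is the one induced on a set `s`. -/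
theorem edgeless_or_star_or_triangle {s : Set V}
    (h : ∀ a ∈ s, ∀ b ∈ s, ∀ c ∈ s, ∀ d ∈ s, G.Adj a b → G.Adj c d →
      a = c ∨ a = d ∨ b = c ∨ b = d) :
    (∀ p ∈ s, ∀ q ∈ s, ¬ G.Adj p q) ∨
    (∃ c ∈ s, ∃ l ∈ s, G.Adj c l ∧ ∀ p ∈ s, ∀ q ∈ s, G.Adj p q → p = c ∨ q = c) ∨
    (∃ a ∈ s, ∃ b ∈ s, ∃ c ∈ s, G.Adj a b ∧ G.Adj a c ∧ G.Adj b c ∧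
      ∀ p ∈ s, ∀ q ∈ s, G.Adj p q → p = a ∨ p = b ∨ p = c) := by
  by_cases h0 : ∀ p ∈ s, ∀ q ∈ s, ¬ G.Adj p q
  · exact .inl h0
  push Not at h0
  obtain ⟨a, ha, b, hb, hab⟩ := h0
  refine .inr ?_
  by_cases h1 : ∀ p ∈ s, ∀ q ∈ s, G.Adj p q → p = a ∨ q = a
  · exact .inl ⟨a, ha, b, hb, hab, h1⟩
  by_cases h2 : ∀ p ∈ s, ∀ q ∈ s, G.Adj p q → p = b ∨ q = b
  · exact .inl ⟨b, hb, a, ha, hab.symm, h2⟩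
  -- An edge avoiding `a` is `b c`, an edge avoiding `b` is `a d`, and these two meet in `c = d`.
  have h3 : ∃ c ∈ s, G.Adj b c ∧ c ≠ a := by
    push Not at h1
    obtain ⟨p, hp, q, hq, hpq, hpa, hqa⟩ := h1
    rcases h a ha b hb p hp q hq hab hpq with e | e | e | e
    · exact absurd e.symm hpa
    · exact absurd e.symm hqa
    · exact ⟨q, hq, e ▸ hpq, hqa⟩
    · exact ⟨p, hp, e ▸ hpq.symm, hpa⟩
  have h4 : ∃ d ∈ s, G.Adj a d ∧ d ≠ b := by
    push Not at h2
    obtain ⟨p, hp, q, hq, hpq, hpa, hqa⟩ := h2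
    rcases h a ha b hb p hp q hq hab hpq with e | e | e | e
    · exact ⟨q, hq, e ▸ hpq, hqa⟩
    · exact ⟨p, hp, e ▸ hpq.symm, hpa⟩
    · exact absurd e.symm hpa
    · exact absurd e.symm hqa
  obtain ⟨c, hc, hbc, hca⟩ := h3
  obtain ⟨d, hd, had, hdb⟩ := h4
  obtain rfl : c = d := by
    rcases h b hb c hc a ha d hd hbc had with e | e | e | e
    · exact absurd e.symm hab.ne
    · exact absurd e.symm hdb
    · exact absurd e hca
    · exact e
  refine .inr ⟨a, ha, b, hb, c, hc, hab, had, hbc, fun p hp q hq hpq => ?_⟩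
  by_contra! hne
  obtain ⟨n1, n2, n3⟩ := hne
  have hab' := hab.ne
  have := h a ha b hb p hp q hq hab hpq
  have := h a ha c hc p hp q hq had hpq
  have := h b hb c hc p hp q hq hbc hpq
  grind

end Forbidden

/-! ### The structure of graphs attaining the bound -/

section Structure

variable {V : Type*} [Fintype V] [DecidableEq V] {G : SimpleGraph V} [DecidableRel G.Adj]

/-- A bound for the right-hand side of `sum_farFinset_add_two_mul_sq_sub` which keeps `r` small when
the neighbourhood of `u` has few edges. -/
theorem sum_neighborFinset_le_sum_codegree {x : V → ℝ} {u : V} {r : ℝ}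
    (hx1 : ∀ v, x v ≤ 1) (hu : x u = 1)
    (hx : ∀ v, ∑ w ∈ G.neighborFinset v, x w = r * x v) :
    ∑ v ∈ G.neighborFinset u, (2 * ((codegree G u v : ℝ) - 1) * x v - codegree G u v)
      ≤ ∑ v ∈ G.neighborFinset u, (codegree G u v : ℝ) - 2 * r := by
  have hr : r = ∑ v ∈ G.neighborFinset u, x v := by rw [hx u, hu, mul_one]
  rw [hr, Finset.mul_sum, ← Finset.sum_sub_distrib]
  refine Finset.sum_le_sum fun v _ => ?_
  have := mul_le_mul_of_nonneg_left (hx1 v) (Nat.cast_nonneg (α := ℝ) (codegree G u v))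
  linarith

/-- The neighbourhood sum when the edges inside the neighbourhood of `u` form a star with
centre `c`. -/
theorem sum_neighborFinset_of_star {x : V → ℝ} {u c : V} (hc : G.Adj u c)
    (hcov : ∀ p, G.Adj u p → ∀ q, G.Adj u q → G.Adj p q → p = c ∨ q = c) :
    ∑ v ∈ G.neighborFinset u, (2 * ((codegree G u v : ℝ) - 1) * x v - codegree G u v)
      = 2 * ((codegree G u c : ℝ) - 1) * x c - 2 * codegree G u c
        - 2 * ∑ v ∈ (G.neighborFinset u).erase c with ¬ G.Adj c v, x v := by
  have hcN : c ∈ G.neighborFinset u := by simpa using hc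
  have hk (v : V) (hv : v ∈ (G.neighborFinset u).erase c) :
      codegree G u v = if G.Adj c v then 1 else 0 := by
    rw [Finset.mem_erase, SimpleGraph.mem_neighborFinset] at hv
    split_ifs with h
    · rw [codegree, Finset.card_eq_one]
      refine ⟨c, ?_⟩
      ext w
      simp only [Finset.mem_inter, SimpleGraph.mem_neighborFinset, Finset.mem_singleton]
      constructor
      · rintro ⟨h1, h2⟩
        exact (hcov v hv.2 w h1 h2).resolve_left hv.1
      · rintro rfl
        exact ⟨hc, h.symm⟩
    · rw [codegree, Finset.card_eq_zero, Finset.eq_empty_iff_forall_notMem]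
      intro w hw
      simp only [Finset.mem_inter, SimpleGraph.mem_neighborFinset] at hw
      obtain rfl := (hcov v hv.2 w hw.1 hw.2).resolve_left hv.1
      exact h hw.2.symm
  have hcard : (codegree G u c : ℝ)
      = ∑ v ∈ (G.neighborFinset u).erase c, if G.Adj c v then (1 : ℝ) else 0 := by
    rw [Finset.sum_boole, codegree]
    congr 2
    ext w
    simp only [Finset.mem_inter, SimpleGraph.mem_neighborFinset, Finset.mem_filter,
      Finset.mem_erase]
    exact ⟨fun h => ⟨⟨h.2.ne', h.1⟩, h.2⟩, fun h => ⟨h.1.2, h.2⟩⟩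
  have hsum : ∑ v ∈ (G.neighborFinset u).erase c,
        (2 * ((codegree G u v : ℝ) - 1) * x v - codegree G u v)
      = - (codegree G u c : ℝ)
        - 2 * ∑ v ∈ (G.neighborFinset u).erase c with ¬ G.Adj c v, x v := by
    rw [hcard, Finset.sum_filter, Finset.mul_sum, ← Finset.sum_neg_distrib,
      ← Finset.sum_sub_distrib]
    refine Finset.sum_congr rfl fun v hv => ?_
    rw [hk v hv]
    split_ifs <;> simp
  rw [← Finset.add_sum_erase _ _ hcN, hsum]
  ring

/-- A graph whose largest eigenvalue `r` reaches the bound, in the form `m - 1 ≤ r ^ 2 - r`, has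
two adjacent vertices which are joined to all other vertices and cover all edges. -/
theorem exists_dominating_edge (h33 : (cycleTriangle 3).Free G) (h43 : (cycleTriangle 4).Free G)
    (hiso : ∀ v, ¬ G.IsIsolated v) {x : V → ℝ} {u : V} {r : ℝ}
    (hx0 : ∀ v, 0 ≤ x v) (hx1 : ∀ v, x v ≤ 1) (hu : x u = 1)
    (hx : ∀ v, ∑ w ∈ G.neighborFinset v, x w = r * x v) (hr4 : 4 < r)
    (hr : (G.edgeFinset.card : ℝ) - 1 ≤ r ^ 2 - r) :
    r ^ 2 - r = (G.edgeFinset.card : ℝ) - 1 ∧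
      ∃ c, u ≠ c ∧ ∀ v w, G.Adj v w ↔ v ≠ w ∧ ((v = u ∨ v = c) ∨ (w = u ∨ w = c)) := by
  have hid := sum_farFinset_add_two_mul_sq_sub G hu hx
  have hterm (w : V) : 0 ≤ ((G.degree w : ℝ) - codegree G u w)
        + 2 * (codegree G u w * (1 - x w)) := by
    have h1 : (codegree G u w : ℝ) ≤ G.degree w := by exact_mod_cast codegree_le_degree G u w
    have h2 : (0 : ℝ) ≤ codegree G u w * (1 - x w) :=
      mul_nonneg (Nat.cast_nonneg _) (sub_nonneg.mpr (hx1 w))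
    linarith
  have hT := Finset.sum_nonneg fun w (_ : w ∈ farFinset G u) => hterm w
  have hpos (v : V) (hv : G.Adj u v) : 0 < x v := by
    have h1 : x u ≤ ∑ w ∈ G.neighborFinset v, x w :=
      Finset.single_le_sum (fun w _ => hx0 w) (by simpa using hv.symm)
    rw [hx v, hu] at h1
    by_contra h2
    have := le_antisymm (not_lt.mp h2) (hx0 v)
    rw [this] at h1
    linarith
  have hrsum : ∑ v ∈ G.neighborFinset u, x v = r := by rw [hx u, hu, mul_one]
  have hNr : r ≤ (G.neighborFinset u).card := by
    rw [← hrsum]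
    simpa using Finset.sum_le_sum fun v (_ : v ∈ G.neighborFinset u) => hx1 v
  have hlow := sum_neighborFinset_le_sum_codegree hx1 hu hx
  rcases edgeless_or_star_or_triangle (G := G) (s := {v | G.Adj u v})
    (fun a ha b hb c hc d hd hab hcd => edges_meet_of_free h33 ha hb hc hd hab hcd)
    with h0 | ⟨c, hc, l, hl, hcl, hcov⟩ | ⟨a, ha, b, hb, c, hc, hab, hac, hbc, hcov⟩
  · have hk : ∑ v ∈ G.neighborFinset u, (codegree G u v : ℝ) = 0 := by
      refine Finset.sum_eq_zero fun v hv => ?_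
      rw [Nat.cast_eq_zero, codegree, Finset.card_eq_zero, Finset.eq_empty_iff_forall_notMem]
      intro w hw
      simp only [Finset.mem_inter, SimpleGraph.mem_neighborFinset] at hw hv
      exact h0 v hv w hw.1 hw.2
    exfalso
    linarith
  · replace hcov : ∀ p, G.Adj u p → ∀ q, G.Adj u q → G.Adj p q → p = c ∨ q = c := hcov
    replace hc : G.Adj u c := hc
    replace hl : G.Adj u l := hl
    have hstar := sum_neighborFinset_of_star (x := x) hc hcov
    have hk1 : (1 : ℝ) ≤ codegree G u c := by
      have : 0 < codegree G u c := Finset.card_pos.mpr ⟨l, by simp [hl, hcl]⟩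
      exact_mod_cast this
    have hS : 0 ≤ ∑ v ∈ (G.neighborFinset u).erase c with ¬ G.Adj c v, x v :=
      Finset.sum_nonneg fun v _ => hx0 v
    have hkx : ((codegree G u c : ℝ) - 1) * x c ≤ (codegree G u c : ℝ) - 1 :=
      mul_le_of_le_one_right (by linarith) (hx1 c)
    have hT0 : ∑ w ∈ farFinset G u, (((G.degree w : ℝ) - codegree G u w)
        + 2 * (codegree G u w * (1 - x w))) = 0 := by linarith
    have hS0 : ∑ v ∈ (G.neighborFinset u).erase c with ¬ G.Adj c v, x v = 0 := by linarith
    refine ⟨by linarith, c, hc.ne, ?_⟩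
    -- Every neighbour of `u` other than `c` is adjacent to `c`, as its entry is positive.
    have hall (v : V) (hv : G.Adj u v) (hvc : v ≠ c) : G.Adj c v := by
      by_contra h
      rw [Finset.sum_eq_zero_iff_of_nonneg fun v _ => hx0 v] at hS0
      exact (hpos v hv).ne' (hS0 v (by simp [hv, hvc, h]))
    -- A vertex far from `u` would have entry `1` and the same neighbours as `u`, which gives a
    -- cycle of length four through `u` disjoint from the rest of a triangle at `u`.
    have hfar (w : V) : w = u ∨ G.Adj u w := by
      by_contra! hw
      have hw0 := (Finset.sum_eq_zero_iff_of_nonneg fun w _ => hterm w).mp hT0 w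
        ((mem_farFinset G).mpr hw)
      have h1 : (codegree G u w : ℝ) ≤ G.degree w := by exact_mod_cast codegree_le_degree G u w
      have h2 : (0 : ℝ) ≤ codegree G u w * (1 - x w) :=
        mul_nonneg (Nat.cast_nonneg _) (sub_nonneg.mpr (hx1 w))
      have hcd : codegree G u w = G.degree w := by
        have : (codegree G u w : ℝ) = G.degree w := by linarith
        exact_mod_cast this
      have hxw : x w = 1 := by
        have h3 : (codegree G u w : ℝ) * (1 - x w) = 0 := by linarith
        rcases mul_eq_zero.mp h3 with h4 | h4
        · exfalso
          rw [hcd, Nat.cast_eq_zero, SimpleGraph.degree, Finset.card_eq_zero] at h4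
          refine hiso w fun z hz => ?_
          have : z ∈ G.neighborFinset w := by simpa using hz
          simp [h4] at this
        · linarith
      have hsub : G.neighborFinset w ⊆ G.neighborFinset u := by
        have := Finset.eq_of_subset_of_card_le
          (Finset.inter_subset_right (s₁ := G.neighborFinset u) (s₂ := G.neighborFinset w))
          hcd.ge
        rw [← this]
        exact Finset.inter_subset_left
      have hNw (v : V) (hv : G.Adj u v) : G.Adj w v := by
        by_contra hwv
        have : ∑ z ∈ G.neighborFinset w, x z < ∑ z ∈ G.neighborFinset u, x z :=
          Finset.sum_lt_sum_of_subset hsub (i := v) (by simpa using hv) (by simpa using hwv)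
            (hpos v hv) fun z _ _ => hx0 z
        rw [hx w, hx u, hxw, hu] at this
        exact lt_irrefl _ this
      have hcard : 2 < ((G.neighborFinset u).erase c).card := by
        rw [Finset.card_erase_of_mem (by simpa using hc)]
        have : 4 < (G.neighborFinset u).card := by exact_mod_cast hr4.trans_le hNr
        omega
      obtain ⟨p, q, s, hp, hq, hs, hpq, hps, hqs⟩ := Finset.two_lt_card_iff.mp hcard
      rw [Finset.mem_erase, SimpleGraph.mem_neighborFinset] at hp hq hs
      refine not_adj_of_free h43 hp.2 hq.2 hc hs.2 (hall s hs.2 hs.1) hw.1 ?_ ?_ hpq hp.1 hps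
        hq.1 hqs (hNw p hp.2) (hNw q hq.2)
      · rintro rfl; exact hw.2 hc
      · rintro rfl; exact hw.2 hs.2
    intro v w
    constructor
    · intro hvw
      refine ⟨hvw.ne, ?_⟩
      rcases hfar v with rfl | hv
      · simp
      rcases hfar w with rfl | hw
      · simp
      rcases hcov v hv w hw hvw with h | h <;> simp [h]
    · have key (v w : V) (hvw : v ≠ w) (h : v = u ∨ v = c) : G.Adj v w := by
        rcases h with rfl | rfl
        · exact (hfar w).resolve_left hvw.symm
        · rcases hfar w with rfl | hw
          · exact hc.symm
          · exact hall w hw hvw.symm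
      rintro ⟨hvw, h | h⟩
      · exact key v w hvw h
      · exact (key w v hvw.symm h).symm
  · have hk : ∑ v ∈ G.neighborFinset u, (codegree G u v : ℝ) ≤ 6 := by
      calc ∑ v ∈ G.neighborFinset u, (codegree G u v : ℝ)
          ≤ ∑ v ∈ G.neighborFinset u, if v ∈ ({a, b, c} : Finset V) then (2 : ℝ) else 0 := by
            refine Finset.sum_le_sum fun v hv => ?_
            rw [SimpleGraph.mem_neighborFinset] at hv
            have hsub : G.neighborFinset u ∩ G.neighborFinset v
                ⊆ ({a, b, c} : Finset V).erase v := by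
              intro w hw
              simp only [Finset.mem_inter, SimpleGraph.mem_neighborFinset] at hw
              simp only [Finset.mem_erase, Finset.mem_insert, Finset.mem_singleton]
              exact ⟨hw.2.ne', hcov w hw.1 v hv hw.2.symm⟩
            split_ifs with h
            · have h1 := Finset.card_le_card hsub
              rw [Finset.card_erase_of_mem h] at h1
              have h2 : codegree G u v ≤ 2 := h1.trans (Nat.sub_le_sub_right Finset.card_le_three 1)
              exact_mod_cast h2
            · rw [Nat.cast_nonpos, codegree, Finset.card_eq_zero,
                Finset.eq_empty_iff_forall_notMem]
              intro w hw
              simp only [Finset.mem_inter, SimpleGraph.mem_neighborFinset] at hw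
              exact h (by simpa using hcov v hv w hw.1 hw.2)
        _ ≤ ∑ v ∈ ({a, b, c} : Finset V), (2 : ℝ) := by
            rw [← Finset.sum_filter]
            exact Finset.sum_le_sum_of_subset_of_nonneg
              (fun v hv => (Finset.mem_filter.mp hv).2) fun _ _ _ => zero_le_two
        _ ≤ 6 := by
            have : (({a, b, c} : Finset V).card : ℝ) ≤ 3 := by exact_mod_cast Finset.card_le_three
            rw [Finset.sum_const, nsmul_eq_mul]
            linarith
    exfalso
    linarith

end Structure

/-! ### The graphs `S_{n,2}` -/

theorem completeSplit_two_adj {n : ℕ} {i j : Fin n} :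
    (completeSplit n 2).Adj i j ↔ i ≠ j ∧ (i.val < 2 ∨ j.val < 2) := Iff.rfl

/-- A graph with a dominating edge covering all edges is `S_{n,2}`. -/
theorem nonempty_iso_completeSplit {V : Type*} [Fintype V] {G : SimpleGraph V} {u c : V}
    (huc : u ≠ c) (h : ∀ v w, G.Adj v w ↔ v ≠ w ∧ ((v = u ∨ v = c) ∨ (w = u ∨ w = c))) :
    Nonempty (G ≃g completeSplit (Fintype.card V) 2) := by
  classical
  have hcard : 2 ≤ Fintype.card V := by
    rw [← Finset.card_pair huc]
    exact Finset.card_le_univ _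
  obtain ⟨e₀⟩ : Nonempty (V ≃ Fin (Fintype.card V)) := ⟨Fintype.equivFin V⟩
  have hp : Fintype.card {v // v = u ∨ v = c} = 2 := by
    rw [Fintype.card_subtype, ← Finset.card_pair huc]
    congr 1
    ext v
    simp
  have hq : Fintype.card {v // (e₀ v).val < 2} = 2 := by
    rw [Fintype.card_congr (e₀.subtypeEquiv (q := fun i => i.val < 2) fun v => Iff.rfl),
      Fintype.card_subtype, Fin.card_filter_val_lt, min_eq_right hcard]
  let e := Fintype.equivOfCardEq (hp.trans hq.symm)
  have he (v : V) : (e₀ (e.extendSubtype v)).val < 2 ↔ v = u ∨ v = c :=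
    ⟨fun h' => by_contra fun hv => e.extendSubtype_not_mem v hv h', e.extendSubtype_mem v⟩
  refine ⟨⟨e.extendSubtype.trans e₀, fun {v w} => ?_⟩⟩
  rw [completeSplit_two_adj, h, Equiv.trans_apply, Equiv.trans_apply, he, he,
    e₀.injective.ne_iff, e.extendSubtype.injective.ne_iff]

/-- A triangle of `S_{n,2}` contains both dominating vertices, so an edge disjoint from it cannot
exist; but in `H(ℓ,3)` the cycle has an edge disjoint from the triangle. -/
theorem cycleTriangle_free_completeSplit_two {l : ℕ} (hl : 3 ≤ l) (n : ℕ) :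
    (cycleTriangle l).Free (completeSplit n 2) := by
  rintro ⟨f, hf⟩
  obtain ⟨k, rfl⟩ := Nat.exists_eq_add_of_le' hl
  have h1 : (cycleTriangle (k + 3)).Adj (.inl 0) (.inr 0) := rfl
  have h2 : (cycleTriangle (k + 3)).Adj (.inl 0) (.inr 1) := rfl
  have h3 : (cycleTriangle (k + 3)).Adj (.inr 0) (.inr 1) := Fin.zero_ne_one
  have h4 : (cycleTriangle (k + 3)).Adj (.inl 1) (.inl 2) := by
    change (SimpleGraph.cycleGraph (k + 3)).Adj 1 2
    rw [SimpleGraph.cycleGraph_adj]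
    right
    rw [Fin.ext_iff, Fin.sub_val_of_le (by simp [Fin.le_def, Nat.mod_eq_of_lt])]
    simp [Nat.mod_eq_of_lt]
  have hne (p q) (hpq : p ≠ q) : (f p).val ≠ (f q).val := fun h => hpq (hf (Fin.ext h))
  have e1 := (f.map_adj h1).2
  have e2 := (f.map_adj h2).2
  have e3 := (f.map_adj h3).2
  have e4 := (f.map_adj h4).2
  have n1 := hne (.inl 0) (.inr 0) (by simp)
  have n2 := hne (.inl 0) (.inr 1) (by simp)
  have n3 := hne (.inr 0) (.inr 1) (by simp)
  have m1 := hne (.inl 1) (.inl 0) (by simp)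
  have m2 := hne (.inl 1) (.inr 0) (by simp)
  have m3 := hne (.inl 1) (.inr 1) (by simp)
  have m4 := hne (.inl 2) (.inl 0) (by simp [Fin.ext_iff, Nat.mod_eq_of_lt])
  have m5 := hne (.inl 2) (.inr 0) (by simp)
  have m6 := hne (.inl 2) (.inr 1) (by simp)
  omega

theorem neighborFinset_completeSplit_two_of_lt {n : ℕ} [DecidableRel (completeSplit n 2).Adj]
    {i : Fin n} (hi : i.val < 2) :
    (completeSplit n 2).neighborFinset i = Finset.univ.erase i := by
  ext j
  simp [completeSplit_two_adj, hi, eq_comm]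

theorem neighborFinset_completeSplit_two_of_le {k : ℕ}
    [DecidableRel (completeSplit (k + 2) 2).Adj] {i : Fin (k + 2)} (hi : 2 ≤ i.val) :
    (completeSplit (k + 2) 2).neighborFinset i = {0, 1} := by
  ext j
  simp only [SimpleGraph.mem_neighborFinset, completeSplit_two_adj, Finset.mem_insert,
    Finset.mem_singleton, Fin.ext_iff, Fin.val_zero, Fin.val_one]
  omega

theorem card_edgeFinset_completeSplit_two (k : ℕ) [DecidableRel (completeSplit (k + 2) 2).Adj] :
    (completeSplit (k + 2) 2).edgeFinset.card = 2 * k + 1 := by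
  have h := (completeSplit (k + 2) 2).sum_degrees_eq_twice_card_edges
  rw [Fin.sum_univ_succ, Fin.sum_univ_succ] at h
  simp_rw [← SimpleGraph.card_neighborFinset_eq_degree] at h
  rw [neighborFinset_completeSplit_two_of_lt (by simp),
    neighborFinset_completeSplit_two_of_lt (by simp),
    Finset.sum_congr rfl fun i _ => by
      rw [neighborFinset_completeSplit_two_of_le (by simp)]] at h
  simp at h
  omega

/-- The vector with entry `r` on the dominating edge and `2` elsewhere is an eigenvector. -/
theorem le_adjSpectralRadius_completeSplit_two {k : ℕ} {r : ℝ} (hr0 : r ≠ 0)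
    (hr : r ^ 2 - r = 2 * k) : r ≤ adjSpectralRadius (completeSplit (k + 2) 2) := by
  classical
  refine le_adjSpectralRadius_of_eigenvector _ (x := fun i => if i.val < 2 then r else 2)
    (Function.ne_iff.mpr ⟨0, by simpa using hr0⟩) fun i => ?_
  by_cases hi : i.val < 2
  · rw [neighborFinset_completeSplit_two_of_lt hi, if_pos hi,
      Finset.sum_erase_eq_sub (Finset.mem_univ i), if_pos hi, Fin.sum_univ_succ,
      Fin.sum_univ_succ]
    simp
    linarith
  · rw [neighborFinset_completeSplit_two_of_le (not_lt.mp hi), if_neg hi,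
      Finset.sum_pair (by simp)]
    simp
    ring

theorem isAdmissible_completeSplit_two (k : ℕ) :
    IsAdmissible (completeSplit (k + 2) 2) (2 * k + 1) where
  free33 := cycleTriangle_free_completeSplit_two le_rfl _
  free43 := cycleTriangle_free_completeSplit_two (by norm_num) _
  not_isIsolated v h := by
    by_cases hv : v = 0
    · exact h 1 (by simp [completeSplit_two_adj, hv])
    · exact h 0 (by simp [completeSplit_two_adj, hv])
  size := by
    classical
    rw [Set.ncard_eq_toFinset_card', ← card_edgeFinset_completeSplit_two k]
    rfl

/-! ### The bound and the case of equality -/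

/-- A graph whose spectral radius reaches the bound attains it exactly, and is `S_{n,2}`. -/
theorem eq_and_nonempty_iso_of_le_adjSpectralRadius {V : Type*} [Fintype V] {G : SimpleGraph V}
    {m : ℕ} (hm : 14 ≤ m) (hG : IsAdmissible G m)
    (hle : (1 + √(4 * (m : ℝ) - 3)) / 2 ≤ adjSpectralRadius G) :
    adjSpectralRadius G = (1 + √(4 * (m : ℝ) - 3)) / 2 ∧
      Nonempty (G ≃g completeSplit ((m + 3) / 2) 2) := by
  classical
  have hcard : G.edgeFinset.card = m := by
    rw [← hG.size, Set.ncard_eq_toFinset_card']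
    rfl
  have : Nonempty V := by
    obtain ⟨e, -⟩ := Finset.card_pos.mp (by omega : 0 < G.edgeFinset.card)
    exact e.ind fun v _ => ⟨v⟩
  have hm' : (14 : ℝ) ≤ m := by exact_mod_cast hm
  have hsq : √(4 * (m : ℝ) - 3) ^ 2 = 4 * m - 3 := Real.sq_sqrt (by linarith)
  have h7 : 7 < √(4 * (m : ℝ) - 3) := Real.lt_sqrt_of_sq_lt (by linarith)
  obtain ⟨x, u, hx0, hx1, hu, hx⟩ := exists_nonneg_eigenvector G (adjSpectralRadius_isGreatest G)
  obtain ⟨heq, c, huc, hadj⟩ := exists_dominating_edge hG.free33 hG.free43 hG.not_isIsolated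
    hx0 hx1 hu hx (by linarith) (by rw [hcard]; nlinarith)
  rw [hcard] at heq
  refine ⟨by nlinarith, ?_⟩
  obtain ⟨f⟩ := nonempty_iso_completeSplit huc hadj
  have hV : 2 ≤ Fintype.card V := by
    rw [← Finset.card_pair huc]
    exact Finset.card_le_univ _
  obtain ⟨k, hk⟩ := Nat.exists_eq_add_of_le' hV
  rw [hk] at f
  have h1 := f.card_edgeFinset_eq
  rw [hcard, card_edgeFinset_completeSplit_two] at h1
  rw [show (m + 3) / 2 = k + 2 by omega]
  exact ⟨f⟩

theorem theorem1p1 (m : ℕ) (hm : 259 ≤ m) (hodd : Odd m) :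
    (IsAdmissible (completeSplit ((m + 3) / 2) 2) m ∧
      adjSpectralRadius (completeSplit ((m + 3) / 2) 2) = (1 + √(4 * (m : ℝ) - 3)) / 2) ∧
    ∀ (V : Type*) [Fintype V] (G : SimpleGraph V), IsAdmissible G m →
      adjSpectralRadius G ≤ (1 + √(4 * (m : ℝ) - 3)) / 2 ∧
      (adjSpectralRadius G = (1 + √(4 * (m : ℝ) - 3)) / 2 ↔
        Nonempty (G ≃g completeSplit ((m + 3) / 2) 2)) := by
  obtain ⟨k, rfl⟩ := hodd
  have hS := isAdmissible_completeSplit_two k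
  have hsqrt : √(4 * ((2 * k + 1 : ℕ) : ℝ) - 3) ^ 2 = 4 * ((2 * k + 1 : ℕ) : ℝ) - 3 :=
    Real.sq_sqrt (by push_cast; linarith [(Nat.cast_nonneg k : (0 : ℝ) ≤ k)])
  have hle : (1 + √(4 * ((2 * k + 1 : ℕ) : ℝ) - 3)) / 2
      ≤ adjSpectralRadius (completeSplit (k + 2) 2) := by
    refine le_adjSpectralRadius_completeSplit_two (by positivity) ?_
    push_cast at hsqrt ⊢
    linarith
  have hSr := (eq_and_nonempty_iso_of_le_adjSpectralRadius (by omega) hS hle).1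
  have hn : (2 * k + 1 + 3) / 2 = k + 2 := by omega
  rw [hn]
  refine ⟨⟨hS, hSr⟩, fun V _ G hG => ⟨?_, fun h => ?_, fun ⟨f⟩ => ?_⟩⟩
  · by_contra! hlt
    exact hlt.ne' (eq_and_nonempty_iso_of_le_adjSpectralRadius (by omega) hG hlt.le).1
  · rw [← hn]
    exact (eq_and_nonempty_iso_of_le_adjSpectralRadius (by omega) hG h.ge).2
  · rw [f.adjSpectralRadius_eq, hSr]
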